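/- Let $S^1=\mathbb R/\mathbb Z$, let $\mathrm{Homeo}_+(S^1)$ be the group of its orientation-preserving homeomorphisms, and let $G\le \mathrm{Homeo}_+(S^1)$ be a subgroup with no non-abelian free subgroups. Then (i) $G$ is abelian, or (ii) the following holds. The set $G_0=\{g\in G : g(x)=x \text{ for some } x\in S^1\}$ is a normal subgroup of $G$, and the quotient $T:=G/G_0$ is isomorphic to a countable subgroup of $\mathbb R/\mathbb Z$. The group $G_0$ has a common fixed point. For every common fixed point $s$ of $G_0$, let $U=S^1\setminus\overline{G s}$ be the complement of the closure of the $G$-orbit of $s$. Then there is a family $\{I_i\}_{i\in\mathcal I}$ of connected components of $U$ whose union $D=\bigcup_i I_i$ is a fundamental domain for the action of $T$ on $U$, that is, $g(D)\cap h(D)=\emptyset$ whenever $g,h\in G$ lie in different cosets of $G_0$, and $U=\bigcup_{g\in G}g(D)$. For every such family, $\mathcal I$ is at most countable, every $I_i$ is an open interval of the circle, every element of $G_0$ maps every $I_i$ onto itself preserving orientation, the group $H_0:=G_0|_D\le\prod_{i\in\mathcal I}\mathrm{Homeo}_+(I_i)$ of restrictions to $D$ of elements of $G_0$ has no non-abelian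 free subgroups, and there is an injective group homomorphism $G\hookrightarrow H_0\wr T$ into the standard unrestricted wreath product $H_0\wr T=\left(\prod_{t\in T}H_0\right)\rtimes T$, where $T$ permutes the coordinates by translation. -/

import Mathlib

/-- The circle `S¹ = ℝ/ℤ`. -/
abbrev S1 : Type := UnitAddCircle

/-- `Homeo₊(S¹)`: the group of orientation-preserving homeomorphisms of the circle, i.e. of those
homeomorphisms that lift to an increasing bijection of the universal cover `ℝ`. -/
def HomeoPlusCircle : Subgroup (S1 ≃ₜ S1) where
  carrier := {f | ∃ F : ℝ ≃o ℝ, ∀ t : ℝ, ((F t : ℝ) : S1) = f (t : S1)}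
  mul_mem' := by
    rintro f g ⟨F, hF⟩ ⟨K, hK⟩
    exact ⟨K.trans F, fun t => by
      rw [OrderIso.trans_apply, hF, hK]; rfl⟩
  one_mem' := ⟨OrderIso.refl ℝ, fun _ => rfl⟩
  inv_mem' := by
    rintro f ⟨F, hF⟩
    refine ⟨F.symm, fun t => f.injective ?_⟩
    rw [← hF, OrderIso.apply_symm_apply]
    exact (f.apply_symm_apply _).symm

/-- A subset of the circle is an open interval (arc) if it is the image of a nonempty real interval
`(a, b)` of length at most `1`. -/
def IsOpenArc (I : Set S1) : Prop :=
  ∃ a b : ℝ, a < b ∧ b ≤ a + 1 ∧ I = (fun t : ℝ => (t : S1)) '' Set.Ioo a b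

/-- `Homeo₊(I)` for an open interval `I` of the circle: the group of homeomorphisms of `I` onto
itself that preserve the (cyclic) order of its points. -/
def HomeoPlusArc (I : Set S1) : Subgroup (I ≃ₜ I) where
  carrier := {h | ∀ x y z : I,
    sbtw (h x : S1) (h y : S1) (h z : S1) ↔ sbtw (x : S1) (y : S1) (z : S1)}
  mul_mem' := by
    intro f g hf hg x y z
    exact (hf (g x) (g y) (g z)).trans (hg x y z)
  one_mem' := fun _ _ _ => Iff.rfl
  inv_mem' := by
    intro f hf x y z
    have h := hf (f.symm x) (f.symm y) (f.symm z)
    simp only [Homeomorph.apply_symm_apply] at h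
    exact h.symm

/-- A group has no non-abelian free subgroups. -/
def NoNonabelianFreeSubgroups (Γ : Type*) [Group Γ] : Prop :=
  ∀ K : Subgroup Γ, IsFreeGroup K → ∀ a ∈ K, ∀ b ∈ K, a * b = b * a

section

variable {G : Subgroup (S1 ≃ₜ S1)}

/-- The set of common fixed points of a subgroup `N` of `G`. -/
def globalFix (N : Subgroup G) : Set S1 :=
  {x | ∀ g ∈ N, (g : S1 ≃ₜ S1) x = x}

/-- The complement of the closure of the `G`-orbit of `s`. -/
def orbitClosureCompl (G : Subgroup (S1 ≃ₜ S1)) (s : S1) : Set S1 :=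
  (closure {x : S1 | ∃ g ∈ G, g s = x})ᶜ

/-- `𝓘` is a family of connected components of the complement `U` of the closure of the `G`-orbit of
`s` whose union `D` is a fundamental domain for the action on `U`: elements of `G` in different
cosets of `N` move `D` to disjoint sets, and the translates of `D` cover `U`. -/
structure IsFundamentalFamily (N : Subgroup G) (s : S1) (𝓘 : Set (Set S1)) : Prop where
  isComponent : ∀ I ∈ 𝓘, ∃ x ∈ orbitClosureCompl G s,
    I = connectedComponentIn (orbitClosureCompl G s) x
  disjoint : ∀ g h : G, (g : G ⧸ N) ≠ (h : G ⧸ N) →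
    Disjoint ((g : S1 ≃ₜ S1) '' ⋃₀ 𝓘) ((h : S1 ≃ₜ S1) '' ⋃₀ 𝓘)
  cover : ⋃ g : G, (g : S1 ≃ₜ S1) '' ⋃₀ 𝓘 = orbitClosureCompl G s

/-- The family `h` of self-maps of the intervals in `𝓘` is the restriction of `g` to their union. -/
def IsRestriction (g : S1 ≃ₜ S1) (𝓘 : Set (Set S1))
    (h : ∀ I : 𝓘, HomeoPlusArc (I : Set S1)) : Prop :=
  ∀ (I : 𝓘) (x : (I : Set S1)), (((h I : (I : Set S1) ≃ₜ (I : Set S1)) x : S1)) = g (x : S1)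

/-- The restriction `N|_D` of `N` to the union `D` of the intervals in `𝓘`, as a subgroup of
`∏ Homeo₊(I)`, `I ∈ 𝓘`. -/
def restrictionGroup (N : Subgroup G) (𝓘 : Set (Set S1)) :
    Subgroup (∀ I : 𝓘, HomeoPlusArc (I : Set S1)) where
  carrier := {h | ∃ g ∈ N, IsRestriction (g : S1 ≃ₜ S1) 𝓘 h}
  mul_mem' := by
    rintro h k ⟨f, hf, hfh⟩ ⟨g, hg, hgk⟩
    refine ⟨f * g, N.mul_mem hf hg, fun I x => ?_⟩
    exact (hfh I _).trans (congrArg (f : S1 ≃ₜ S1) (hgk I x))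
  one_mem' := ⟨1, N.one_mem, fun _ _ => rfl⟩
  inv_mem' := by
    rintro h ⟨f, hf, hfh⟩
    refine ⟨f⁻¹, N.inv_mem hf, fun I x => (f : S1 ≃ₜ S1).injective ?_⟩
    have h1 := hfh I ((h I : (I : Set S1) ≃ₜ (I : Set S1)).symm x)
    rw [Homeomorph.apply_symm_apply] at h1
    exact h1.symm.trans ((f : S1 ≃ₜ S1).apply_symm_apply _).symm

end

/-!
Two elements of `G` with fixed points have a common fixed point: otherwise their fixed point sets
have disjoint neighbourhoods, high powers of the two elements play ping-pong on these, and `G`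
contains a free group of rank two (`exists_common_fixedPoint`). Hence the elements with fixed points
form a normal subgroup `G₀` (`fixedPointSubgroup`), and their lifts to the line that have fixed
points form a group. Each such lift moves every point by less than `1`, so the orbits of this group
are bounded, and the supremum of an orbit is a common fixed point of `G₀`
(`globalFix_fixedPointSubgroup_nonempty`).

An element of the group of all lifts of elements of `G` that has a fixed point fixes the lifts `s` of
common fixed points of `G₀`. Therefore comparing values at `s` is a bi-invariant preorder on this
group, and, as for Archimedean ordered groups, the translation number is additive
(`CircleDeg1Lift.translationNumber_mul_of_fix`). The rotation number is thus a homomorphism from `G`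
to `ℝ/ℤ`, with kernel `G₀` (`exists_rotationHom`).

Let `U` be the complement of the closure of the orbit of a common fixed point of `G₀`. All points
outside `U` are fixed by `G₀`, so `G₀` preserves every component of `U`; conversely an element of `G`
that preserves a component fixes its endpoints and lies in `G₀`. So `G / G₀` acts freely on the
components, which gives fundamental families (`exists_isFundamentalFamily`) and, when `G₀` is
nontrivial, the countability of `G / G₀` (`countable_quotient`). If `G₀` is trivial, `G` embeds in
`ℝ/ℤ` and is abelian. Restriction to a fundamental domain loses no information about an element of
`G₀` if one restricts all its conjugates by `G`, so the Kaluzhnin–Krasner construction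
(`exists_injective_hom_regularWreathProduct`) embeds `G` into the wreath product.
-/

open Set Filter Topology

/-! ### Lifts of circle homeomorphisms to the line -/

/-- `F` is a lift to `ℝ` of the circle homeomorphism `f`. Lifts are taken to be invertible elements
of Mathlib's monoid `CircleDeg1Lift` of monotone degree one maps, so that the theory of translation
numbers applies to them. -/
def IsLift (F : CircleDeg1Liftˣ) (f : S1 ≃ₜ S1) : Prop :=
  ∀ t : ℝ, ((F t : ℝ) : S1) = f (t : S1)

lemma coe_eq_coe_iff_exists_int {x y : ℝ} : (x : S1) = (y : S1) ↔ ∃ m : ℤ, x = y + m := by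
  rw [← sub_eq_zero, ← AddCircle.coe_sub, AddCircle.coe_eq_zero_iff]
  simp only [zsmul_eq_mul, mul_one, eq_sub_iff_add_eq']
  exact exists_congr fun m => eq_comm

lemma CircleDeg1Lift.units_strictMono (F : CircleDeg1Liftˣ) : StrictMono F :=
  (CircleDeg1Lift.toOrderIso F).strictMono

lemma CircleDeg1Lift.units_continuous (F : CircleDeg1Liftˣ) : Continuous F :=
  (CircleDeg1Lift.toOrderIso F).continuous

lemma CircleDeg1Lift.units_mul_apply (F K : CircleDeg1Liftˣ) (x : ℝ) : (F * K) x = F (K x) := rfl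

namespace IsLift

variable {F K : CircleDeg1Liftˣ} {f g : S1 ≃ₜ S1}

lemma one : IsLift 1 1 := fun _ => rfl

lemma mul (hF : IsLift F f) (hK : IsLift K g) : IsLift (F * K) (f * g) := fun t => by
  rw [CircleDeg1Lift.units_mul_apply, hF, hK]; rfl

lemma inv (hF : IsLift F f) : IsLift F⁻¹ f⁻¹ := fun t => f.injective <| by
  rw [← hF, CircleDeg1Lift.units_apply_inv_apply]
  exact (f.apply_symm_apply _).symm

lemma pow (hF : IsLift F f) (n : ℕ) : IsLift (F ^ n) (f ^ n) := by
  induction n with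
  | zero => simpa using one
  | succ n ih => rw [pow_succ, pow_succ]; exact ih.mul hF

lemma translate_int (m : ℤ) :
    IsLift (CircleDeg1Lift.translate (Multiplicative.ofAdd (m : ℝ))) 1 := fun t => by
  rw [CircleDeg1Lift.translate_apply, Homeomorph.one_apply, coe_eq_coe_iff_exists_int]
  exact ⟨m, add_comm _ _⟩

/-- A lift may be corrected by an integer translation so that it takes a prescribed value. -/
lemma exists_apply_eq (hF : IsLift F f) {x y : ℝ} (h : f (x : S1) = y) :
    ∃ F' : CircleDeg1Liftˣ, IsLift F' f ∧ F' x = y := by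
  rw [← hF, eq_comm, coe_eq_coe_iff_exists_int] at h
  obtain ⟨m, hm⟩ := h
  refine ⟨CircleDeg1Lift.translate (Multiplicative.ofAdd (m : ℝ)) * F, ?_, ?_⟩
  · simpa using (translate_int m).mul hF
  · rw [CircleDeg1Lift.units_mul_apply, CircleDeg1Lift.translate_apply, hm, add_comm]

end IsLift

lemma exists_isLift {f : S1 ≃ₜ S1} (hf : f ∈ HomeoPlusCircle) : ∃ F, IsLift F f := by
  obtain ⟨F, hF⟩ := hf
  have hadd : ∀ x, F (x + 1) = F x + 1 := by
    intro x
    have h1 : ((F (x + 1) : ℝ) : S1) = (F x : ℝ) := by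
      rw [hF, hF]; congr 1
      exact coe_eq_coe_iff_exists_int.2 ⟨1, by simp⟩
    obtain ⟨m, hm⟩ := coe_eq_coe_iff_exists_int.1 h1
    have h2 : F x < F (x + 1) := F.strictMono (by linarith)
    have hm0 : 1 ≤ m := by
      have : (0 : ℝ) < m := by linarith
      exact_mod_cast this
    have hm1 : (1 : ℝ) ≤ m := by exact_mod_cast hm0
    -- if `F` moved `x + 1` by more than one full turn, `f` would take the value `f x` again
    -- strictly inside a fundamental interval
    by_contra hne
    have h3 : F x + 1 < F (x + 1) := lt_of_le_of_ne (by linarith) (Ne.symm hne)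
    set u := F.symm (F x + 1) with hu
    have hFu : F u = F x + 1 := F.apply_symm_apply _
    have hxu : x < u := F.lt_iff_lt.1 (by linarith)
    have hux : u < x + 1 := F.lt_iff_lt.1 (by linarith)
    have h4 : (u : S1) = x := f.injective <| by
      rw [← hF, ← hF, hFu]
      exact coe_eq_coe_iff_exists_int.2 ⟨1, by simp⟩
    obtain ⟨k, hk⟩ := coe_eq_coe_iff_exists_int.1 h4
    have hk0 : (0 : ℝ) < k := by linarith
    have hk1 : (k : ℝ) < 1 := by linarith
    have : 0 < k := by exact_mod_cast hk0
    have : k < 1 := by exact_mod_cast hk1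
    omega
  let F₀ : CircleDeg1Lift := ⟨⟨F, F.monotone⟩, hadd⟩
  obtain ⟨u, hu⟩ := CircleDeg1Lift.isUnit_iff_bijective.2
    (show Function.Bijective F₀ from F.bijective)
  exact ⟨u, fun t => by rw [hu]; exact hF t⟩

lemma IsLift.exists_int_of_one {F : CircleDeg1Liftˣ} (hF : IsLift F 1) (x : ℝ) :
    ∃ m : ℤ, F x = x + m :=
  coe_eq_coe_iff_exists_int.1 (hF x)

lemma CircleDeg1Lift.translationNumber_eq_zero_iff (F : CircleDeg1Liftˣ) :
    translationNumber F = 0 ↔ ∃ x, F x = x := by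
  have := translationNumber_eq_int_iff (F : CircleDeg1Lift) (units_continuous F) (m := 0)
  simpa using this

/-- The lift of a homeomorphism with a fixed point that has a fixed point itself fixes every lift of
every fixed point. -/
lemma IsLift.apply_eq_self {F : CircleDeg1Liftˣ} {f : S1 ≃ₜ S1} (hF : IsLift F f) {p x : ℝ}
    (hp : F p = p) (hx : f (x : S1) = x) : F x = x := by
  obtain ⟨m, hm⟩ := coe_eq_coe_iff_exists_int.1 ((hF x).trans hx)
  have h1 := CircleDeg1Lift.translationNumber_of_eq_add_int (F : CircleDeg1Lift) hm
  have h2 := (CircleDeg1Lift.translationNumber_eq_zero_iff F).2 ⟨p, hp⟩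
  rw [h2] at h1
  rw [hm, ← h1, add_zero]

/-! ### Additivity of the translation number -/

lemma CircleDeg1Lift.sub_one_lt_map (F : CircleDeg1Liftˣ) (x : ℝ) :
    x + translationNumber F - 1 < F x := by
  have := (F⁻¹ : CircleDeg1Liftˣ).1.map_lt_add_translationNumber_add_one (F x)
  rw [units_inv_apply_apply, translationNumber_units_inv] at this
  linarith

/-- In a preordered monoid, if `a * b ≤ b * a` then moving all factors `a` to the left makes a word
smaller. -/
lemma pow_mul_pow_le_mul_pow {M : Type*} [Monoid M] [Preorder M] [MulLeftMono M] [MulRightMono M]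
    {a b : M} (h : a * b ≤ b * a) (n : ℕ) : a ^ n * b ^ n ≤ (a * b) ^ n := by
  have hab : ∀ n : ℕ, a ^ n * b ≤ b * a ^ n := by
    intro n
    induction n with
    | zero => simp
    | succ n ih =>
      calc a ^ (n + 1) * b = a ^ n * (a * b) := by rw [pow_succ, mul_assoc]
        _ ≤ a ^ n * (b * a) := mul_le_mul_right h _
        _ = a ^ n * b * a := by rw [mul_assoc]
        _ ≤ b * a ^ n * a := mul_le_mul_left ih _
        _ = b * a ^ (n + 1) := by rw [pow_succ, mul_assoc]
  induction n with
  | zero => simp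
  | succ n ih =>
    calc a ^ (n + 1) * b ^ (n + 1) = a * (a ^ n * b) * b ^ n := by
          rw [pow_succ', pow_succ']; simp only [mul_assoc]
      _ ≤ a * (b * a ^ n) * b ^ n := mul_le_mul_left (mul_le_mul_right (hab n) _) _
      _ = a * b * (a ^ n * b ^ n) := by simp only [mul_assoc]
      _ ≤ a * b * (a * b) ^ n := mul_le_mul_right ih _
      _ = (a * b) ^ (n + 1) := (pow_succ' _ _).symm

/-- If the elements of a group of lifts that have a fixed point all fix `x`, then the translation
number is additive on the group. Indeed, comparing the values at `x` gives a preorder on the group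
that is invariant under multiplication on both sides, and so one of `(F * K) ^ n` and `F ^ n * K ^ n`
moves `x` farther than the other for all `n` simultaneously. -/
lemma CircleDeg1Lift.translationNumber_mul_of_fix (Γ : Subgroup CircleDeg1Liftˣ) (x : ℝ)
    (hx : ∀ F ∈ Γ, (∃ y, F y = y) → F x = x) {F K : CircleDeg1Liftˣ} (hF : F ∈ Γ) (hK : K ∈ Γ) :
    translationNumber (F * K : CircleDeg1Liftˣ) = translationNumber F + translationNumber K := by
  have hfix : ∀ F ∈ Γ, (∃ y, F y = y) → ∀ g ∈ Γ, F (g x) = g x := by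
    rintro F hF ⟨y, hy⟩ g hg
    have h := hx (g⁻¹ * F * g) (Γ.mul_mem (Γ.mul_mem (Γ.inv_mem hg) hF) hg) ⟨g⁻¹ y, by
      simp only [units_mul_apply, units_apply_inv_apply, hy]⟩
    simp only [units_mul_apply] at h
    rw [← units_apply_inv_apply g (F (g x)), h]
  have hright : ∀ F ∈ Γ, ∀ K ∈ Γ, ∀ g ∈ Γ, F x ≤ K x → F (g x) ≤ K (g x) := by
    intro F hF K hK g hg h
    by_contra! hlt
    -- `K⁻¹ * F` moves `x` and `g x` in opposite directions, so it has a fixed point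
    have h1 : (K⁻¹ * F) x ≤ x := by
      have := (units_strictMono K⁻¹).monotone h
      rwa [units_inv_apply_apply] at this
    have h2 : g x < (K⁻¹ * F) (g x) := by
      have := (units_strictMono K⁻¹) hlt
      rwa [units_inv_apply_apply] at this
    obtain ⟨y, hy⟩ : ∃ y, (K⁻¹ * F) y = y := by
      have := mem_range_of_exists_le_of_exists_ge
        ((units_continuous (K⁻¹ * F)).sub continuous_id) (c := 0)
        ⟨x, by simpa using h1⟩ ⟨g x, by simpa using h2.le⟩
      obtain ⟨y, hy⟩ := this
      exact ⟨y, sub_eq_zero.1 hy⟩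
    rw [hfix _ (Γ.mul_mem (Γ.inv_mem hK) hF) ⟨y, hy⟩ g hg] at h2
    exact lt_irrefl _ h2
  let inst : Preorder Γ := Preorder.lift fun F : Γ => (F : CircleDeg1Liftˣ) x
  -- this shadows the pointwise order that `Γ` inherits from `CircleDeg1Lift`
  let _ : LE Γ := inst.toLE
  have : MulLeftMono Γ := ⟨fun F A B h =>
    (units_strictMono F.1).monotone (show A.1 x ≤ B.1 x from h)⟩
  have : MulRightMono Γ := ⟨fun g F K h => hright F F.2 K K.2 g g.2 h⟩
  have key : ∀ F K : Γ, F * K ≤ K * F →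
      translationNumber (F.1 * K.1 : CircleDeg1Liftˣ) =
        translationNumber F.1 + translationNumber K.1 := by
    intro F K hle
    have lower : ∀ n : ℕ, (F.1 ^ n * K.1 ^ n : CircleDeg1Liftˣ) x ≤ ((F.1 * K.1) ^ n :
        CircleDeg1Liftˣ) x := fun n => pow_mul_pow_le_mul_pow hle n
    have upper : ∀ n : ℕ, ((K.1 * F.1) ^ n : CircleDeg1Liftˣ) x ≤ (K.1 ^ n * F.1 ^ n :
        CircleDeg1Liftˣ) x := fun n =>
      pow_mul_pow_le_mul_pow (M := Γᵒᵈ) (a := OrderDual.toDual K) (b := OrderDual.toDual F) hle n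
    have hpow : ∀ (F : CircleDeg1Liftˣ) (n : ℕ),
        translationNumber (F ^ n : CircleDeg1Liftˣ) = n * translationNumber F := fun F n => by
      rw [Units.val_pow_eq_pow_val, translationNumber_pow]
    have hlt : ∀ (F : CircleDeg1Liftˣ) (y : ℝ), F y < y + translationNumber F + 1 :=
      fun F y => F.1.map_lt_add_translationNumber_add_one y
    have hconj : translationNumber (K.1 * F.1 : CircleDeg1Liftˣ) =
        translationNumber (F.1 * K.1 : CircleDeg1Liftˣ) := by
      have := translationNumber_conj_eq K.1 (F.1 * K.1 : CircleDeg1Liftˣ)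
      rw [← this, ← Units.val_mul, ← Units.val_mul]
      congr 2
      group
    have harch : ∀ c : ℝ, (∀ n : ℕ, n * c ≤ 3) → c ≤ 0 := by
      intro c hc
      by_contra! hpos
      obtain ⟨n, hn⟩ := exists_nat_gt (3 / c)
      rw [div_lt_iff₀ hpos] at hn
      exact absurd (hc n) (not_le.2 hn)
    apply le_antisymm
    · rw [← sub_nonpos]
      refine harch _ fun n => ?_
      have h1 := sub_one_lt_map ((K.1 * F.1) ^ n) x
      have h2 := hlt (K.1 ^ n) ((F.1 ^ n : CircleDeg1Liftˣ) x)
      have h3 := hlt (F.1 ^ n) x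
      have h4 := upper n
      rw [units_mul_apply] at h4
      rw [hpow] at h1 h2 h3
      rw [hconj] at h1
      linarith
    · rw [← sub_nonpos]
      refine harch _ fun n => ?_
      have h1 := hlt ((F.1 * K.1) ^ n) x
      have h2 := sub_one_lt_map (F.1 ^ n) ((K.1 ^ n : CircleDeg1Liftˣ) x)
      have h3 := sub_one_lt_map (K.1 ^ n) x
      have h4 := lower n
      rw [units_mul_apply] at h4
      rw [hpow] at h1 h2 h3
      linarith
  rcases le_total (F (K x)) (K (F x)) with h | h
  · exact key ⟨F, hF⟩ ⟨K, hK⟩ h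
  · have h1 := key ⟨K, hK⟩ ⟨F, hF⟩ h
    have h2 := translationNumber_conj_eq K (F * K : CircleDeg1Liftˣ)
    rw [← h2, ← Units.val_mul, ← Units.val_mul]
    rw [show K * (F * K) * K⁻¹ = K * F by group, h1, add_comm]

/-! ### Elements with fixed points and ping-pong -/

lemma CircleDeg1Lift.coe_units_pow (F : CircleDeg1Liftˣ) (n : ℕ) :
    ⇑((F ^ n : CircleDeg1Liftˣ) : CircleDeg1Lift) = F^[n] := by
  rw [Units.val_pow_eq_pow_val, coe_pow]

/-- If `F` has a fixed point, all its orbits are monotone and bounded, hence converge to fixed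
points. -/
lemma CircleDeg1Lift.exists_tendsto_iterate (F : CircleDeg1Liftˣ) {p : ℝ} (hp : F p = p) (x : ℝ) :
    ∃ q, F q = q ∧ Tendsto (fun n : ℕ => F^[n] x) atTop (𝓝 q) := by
  have hmono := (units_strictMono F).monotone
  have hbdd : ∀ n : ℕ, p + ⌊x - p⌋ ≤ F^[n] x ∧ F^[n] x ≤ p + ⌈x - p⌉ := by
    have hfix : ∀ m : ℤ, F (p + m) = p + m := fun m => by rw [map_add_int, hp]
    intro n
    induction n with
    | zero =>
      have h1 := Int.floor_le (x - p)
      have h2 := Int.le_ceil (x - p)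
      simp only [Function.iterate_zero, id]
      constructor <;> linarith
    | succ n ih =>
      rw [Function.iterate_succ_apply']
      exact ⟨(hfix _).ge.trans (hmono ih.1), (hmono ih.2).trans (hfix _).le⟩
  obtain ⟨q, hq⟩ : ∃ q, Tendsto (fun n : ℕ => F^[n] x) atTop (𝓝 q) := by
    rcases le_total x (F x) with h | h
    · exact ⟨_, tendsto_atTop_ciSup (hmono.monotone_iterate_of_le_map h)
        ⟨_, by rintro _ ⟨n, rfl⟩; exact (hbdd n).2⟩⟩
    · exact ⟨_, tendsto_atTop_ciInf (hmono.antitone_iterate_of_map_le h)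
        ⟨_, by rintro _ ⟨n, rfl⟩; exact (hbdd n).1⟩⟩
  exact ⟨q, isFixedPt_of_tendsto_iterate hq (units_continuous F).continuousAt, hq⟩

/-- If `F` has a fixed point, its iterates push every compact set without fixed points into any
neighbourhood of the fixed point set, uniformly. -/
lemma CircleDeg1Lift.exists_forall_iterate_mem (F : CircleDeg1Liftˣ) {p : ℝ} (hp : F p = p)
    {A K : Set ℝ} (hA : IsOpen A) (hfix : ∀ x, F x = x → x ∈ A) (hK : IsCompact K)
    (hKfix : ∀ x ∈ K, F x ≠ x) : ∃ N : ℕ, ∀ n ≥ N, ∀ x ∈ K, F^[n] x ∈ A := by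
  refine hK.induction_on (p := fun s => ∃ N : ℕ, ∀ n ≥ N, ∀ x ∈ s, F^[n] x ∈ A)
    ⟨0, by simp⟩ (fun s t hst ⟨N, hN⟩ => ⟨N, fun n hn x hx => hN n hn x (hst hx)⟩) ?_ ?_
  · rintro s t ⟨N, hN⟩ ⟨M, hM⟩
    exact ⟨max N M, fun n hn x hx => hx.elim (hN n (le_of_max_le_left hn) x)
      (hM n (le_of_max_le_right hn) x)⟩
  intro x hx
  have hmono := units_strictMono F
  obtain ⟨q, hq, hlim⟩ := exists_tendsto_iterate F hp (F⁻¹ x)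
  obtain ⟨ε, hε, hball⟩ := Metric.isOpen_iff.1 hA q (hfix q hq)
  obtain ⟨N, hN⟩ := eventually_atTop.1 (hlim.eventually (Metric.ball_mem_nhds q hε))
  -- the orbits of `F⁻¹ x`, of `F x` and of all points between them have the same limit
  have hN2 : ∀ n ≥ N, F^[n] (F x) ∈ Metric.ball q ε := fun n hn => by
    have := hN (n + 2) (by omega)
    rwa [Function.iterate_add_apply, Function.iterate_succ_apply, Function.iterate_one,
      units_apply_inv_apply] at this
  have hconv : (Metric.ball q ε).OrdConnected := by
    rw [Real.ball_eq_Ioo]; exact ordConnected_Ioo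
  have hinv : F (F⁻¹ x) = x := units_apply_inv_apply F x
  rcases lt_or_gt_of_ne (hKfix x hx) with h | h
  · have h' : x < F⁻¹ x := hmono.lt_iff_lt.1 (by rwa [hinv])
    refine ⟨Ioo (F x) (F⁻¹ x), mem_nhdsWithin_of_mem_nhds (Ioo_mem_nhds h h'), N,
      fun n hn y hy => hball (hconv.out (hN2 n hn) (hN n hn) ⟨?_, ?_⟩)⟩
    · exact hmono.monotone.iterate n hy.1.le
    · exact hmono.monotone.iterate n hy.2.le
  · have h' : F⁻¹ x < x := hmono.lt_iff_lt.1 (by rwa [hinv])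
    refine ⟨Ioo (F⁻¹ x) (F x), mem_nhdsWithin_of_mem_nhds (Ioo_mem_nhds h' h), N,
      fun n hn y hy => hball (hconv.out (hN n hn) (hN2 n hn) ⟨?_, ?_⟩)⟩
    · exact hmono.monotone.iterate n hy.1.le
    · exact hmono.monotone.iterate n hy.2.le

lemma exists_forall_pow_mem {f : S1 ≃ₜ S1} (hf : f ∈ HomeoPlusCircle) (hne : ∃ x, f x = x)
    {A : Set S1} (hA : IsOpen A) (hfix : ∀ x, f x = x → x ∈ A) :
    ∃ N : ℕ, ∀ n ≥ N, ∀ x ∉ A, (f ^ n) x ∈ A := by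
  obtain ⟨p, hp⟩ := hne
  obtain ⟨p, rfl⟩ := QuotientAddGroup.mk_surjective p
  obtain ⟨F₀, hF₀⟩ := exists_isLift hf
  obtain ⟨F, hF, hFp⟩ := hF₀.exists_apply_eq hp
  have hcont : Continuous fun t : ℝ => (t : S1) := AddCircle.continuous_mk' 1
  obtain ⟨N, hN⟩ := CircleDeg1Lift.exists_forall_iterate_mem F hFp (A := (fun t : ℝ => (t : S1)) ⁻¹' A)
    (K := Icc 0 1 ∩ (fun t : ℝ => (t : S1)) ⁻¹' Aᶜ) (hA.preimage hcont)
    (fun x hx => hfix _ (by rw [← hF x, hx]))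
    (isCompact_Icc.inter_right (hA.isClosed_compl.preimage hcont))
    (fun x hx h => hx.2 (hfix _ (by rw [← hF x, h])))
  refine ⟨N, fun n hn x hx => ?_⟩
  obtain ⟨t, ht, rfl⟩ : ∃ t ∈ Ico (0 : ℝ) 1, (t : S1) = x := by
    have := (AddCircle.coe_image_Ico_eq (1 : ℝ) 0).ge (mem_univ x)
    simpa using this
  have h := hN n hn t ⟨⟨ht.1, ht.2.le⟩, hx⟩
  rw [← CircleDeg1Lift.coe_units_pow, mem_preimage, hF.pow n t] at h
  exact h

/-- If `f` has a fixed point, some power of `f` has the property that all its nontrivial powers,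
positive and negative, map the complement of a given neighbourhood `A` of the fixed point set into
`A`. -/
lemma exists_forall_zpow_mem {f : S1 ≃ₜ S1} (hf : f ∈ HomeoPlusCircle) (hne : ∃ x, f x = x)
    {A : Set S1} (hA : IsOpen A) (hfix : ∀ x, f x = x → x ∈ A) :
    ∃ N : ℕ, ∀ k : ℤ, k ≠ 0 → ∀ x ∉ A, ((f ^ N) ^ k) x ∈ A := by
  have hinv : ∀ x, f⁻¹ x = x → f x = x := fun x hx => by
    have := f.apply_symm_apply x
    rwa [show f.symm x = x from hx] at this
  obtain ⟨N, hN⟩ := exists_forall_pow_mem hf hne hA hfix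
  obtain ⟨M, hM⟩ := exists_forall_pow_mem (HomeoPlusCircle.inv_mem hf)
    (hne.imp fun x hx => by rw [Homeomorph.inv_apply, f.symm_apply_eq, hx]) hA
    (fun x hx => hfix x (hinv x hx))
  refine ⟨max N M, fun k hk x hx => ?_⟩
  obtain ⟨n, rfl | rfl⟩ := k.eq_nat_or_neg
  · rw [zpow_natCast, ← pow_mul]
    exact hN _ ((le_max_left N M).trans (Nat.le_mul_of_pos_right _ (by omega))) x hx
  · rw [zpow_neg, zpow_natCast, ← pow_mul, ← inv_pow]
    exact hM _ ((le_max_right N M).trans (Nat.le_mul_of_pos_right _ (by omega))) x hx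

/-- Ping-pong for two elements all of whose nontrivial powers move the sets `B` and `A`,
respectively, into the disjoint sets `A` and `B`. The two copies of `ℤ` in the free product are
taken to be free groups on one generator, so that the product is visibly free. -/
lemma not_noNonabelianFreeSubgroups_of_ping_pong {Γ α : Type} [Group Γ] [MulAction Γ α]
    {a b : Γ} {A B : Set α} (hAB : Disjoint A B) (hA : A.Nonempty) (hB : B.Nonempty)
    (ha : ∀ k : ℤ, k ≠ 0 → ∀ x ∈ B, a ^ k • x ∈ A)
    (hb : ∀ k : ℤ, k ≠ 0 → ∀ x ∈ A, b ^ k • x ∈ B) (hab : a * b ≠ b * a) :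
    ¬ NoNonabelianFreeSubgroups Γ := by
  intro hΓ
  let c : Bool → Γ := fun i => if i then a else b
  let X : Bool → Set α := fun i => if i then A else B
  let φ : ∀ _ : Bool, FreeGroup Unit →* Γ := fun i => FreeGroup.lift fun _ => c i
  have hzpow : ∀ h : FreeGroup Unit, h ≠ 1 → ∃ k : ℤ, k ≠ 0 ∧ ∀ i, φ i h = c i ^ k := by
    intro h hh
    refine ⟨FreeGroup.freeGroupUnitEquivInt h, fun h0 => hh ?_, fun i => ?_⟩
    · rw [← FreeGroup.freeGroupUnitEquivInt.symm_apply_apply h, h0]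
      exact zpow_zero _
    · conv_lhs => rw [← FreeGroup.freeGroupUnitEquivInt.symm_apply_apply h]
      change φ i (FreeGroup.of () ^ (_ : ℤ)) = _
      rw [map_zpow, FreeGroup.lift_apply_of]
  have hinj : Function.Injective (Monoid.CoprodI.lift φ) := by
    refine Monoid.CoprodI.lift_injective_of_ping_pong φ (Or.inr ⟨true, ?_⟩) X ?_ ?_ ?_
    · rw [FreeGroup.freeGroupUnitEquivInt.cardinal_eq, Cardinal.mk_denumerable]
      exact Cardinal.natCast_le_aleph0
    · rintro (_ | _)
      exacts [hB, hA]
    · rintro (_ | _) (_ | _) hij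
      exacts [absurd rfl hij, hAB.symm, hAB, absurd rfl hij]
    · rintro i j hij h hh _ ⟨x, hx, rfl⟩
      obtain ⟨k, hk, hφ⟩ := hzpow h hh
      change φ i h • x ∈ X i
      rw [hφ i]
      rcases i with _ | _ <;> rcases j with _ | _
      exacts [absurd rfl hij, hb k hk x hx, ha k hk x hx, absurd rfl hij]
  have hfree : IsFreeGroup (Monoid.CoprodI.lift φ).range :=
    IsFreeGroup.ofMulEquiv (MonoidHom.ofInjective hinj)
  have hmem : ∀ i, c i ∈ (Monoid.CoprodI.lift φ).range := fun i =>
    ⟨Monoid.CoprodI.of (i := i) (FreeGroup.of ()), by simp [φ]⟩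
  exact hab (hΓ _ hfree _ (hmem true) _ (hmem false))

/-- Two elements with fixed points have a common one, since otherwise high powers of them play
ping-pong on disjoint neighbourhoods of their fixed point sets. -/
lemma exists_common_fixedPoint {G : Subgroup (S1 ≃ₜ S1)} (hG : G ≤ HomeoPlusCircle)
    (hfree : NoNonabelianFreeSubgroups G) {f g : S1 ≃ₜ S1} (hf : f ∈ G) (hg : g ∈ G)
    (hfne : ∃ x, f x = x) (hgne : ∃ x, g x = x) : ∃ x, f x = x ∧ g x = x := by
  by_contra! hdisj
  have hclosed : ∀ f : S1 ≃ₜ S1, IsClosed {x | f x = x} := fun f =>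
    isClosed_eq f.continuous continuous_id
  obtain ⟨A, B, hA, hB, hfA, hgB, hAB⟩ := SeparatedNhds.of_isCompact_isCompact
    (hclosed f).isCompact (hclosed g).isCompact
    (disjoint_left.2 fun x hx hx' => hdisj x hx hx')
  obtain ⟨N, hN⟩ := exists_forall_zpow_mem (hG hf) hfne hA hfA
  obtain ⟨M, hM⟩ := exists_forall_zpow_mem (hG hg) hgne hB hgB
  let _ : MulAction G S1 :=
    { smul := fun h x => (h : S1 ≃ₜ S1) x, one_smul := fun _ => rfl, mul_smul := fun _ _ _ => rfl }
  have hAB' := disjoint_left.1 hAB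
  obtain ⟨x, hx⟩ := hgne
  refine not_noNonabelianFreeSubgroups_of_ping_pong (a := (⟨f, hf⟩ : G) ^ N)
    (b := (⟨g, hg⟩ : G) ^ M) hAB (hfne.imp hfA) ⟨x, hgB hx⟩
    (fun k hk y hy => hN k hk y fun h => hAB' h hy)
    (fun k hk y hy => hM k hk y (hAB' hy)) (fun hcomm => ?_) hfree
  -- a fixed point `x` of `g` is moved into `A` by `f ^ N`, and then into `B` by `g ^ M`; if the two
  -- powers commuted, the resulting point would be `f ^ N x` again
  have hfx : (f ^ N) x ∈ A := by
    simpa using hN 1 one_ne_zero x fun h => hAB' h (hgB hx)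
  have hgfx : (g ^ M) ((f ^ N) x) ∈ B := by
    simpa using hM 1 one_ne_zero _ (hAB' hfx)
  have hgM : ∀ n : ℕ, (g ^ n) x = x := by
    intro n
    induction n with
    | zero => rfl
    | succ n ih => rw [pow_succ, Homeomorph.mul_apply, hx, ih]
  have h1 : f ^ N * g ^ M = g ^ M * f ^ N := congrArg Subtype.val hcomm
  have h2 : (g ^ M) ((f ^ N) x) = (f ^ N) x := by
    rw [← Homeomorph.mul_apply, ← h1, Homeomorph.mul_apply, hgM]
  exact hAB' hfx (h2 ▸ hgfx)

/-! ### The subgroup of elements with fixed points and the rotation number -/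

section

variable {G : Subgroup (S1 ≃ₜ S1)}

/-- The elements of `G` that have a fixed point; they form a subgroup because any two of them have a
common fixed point. -/
def fixedPointSubgroup (hG : G ≤ HomeoPlusCircle) (hfree : NoNonabelianFreeSubgroups G) :
    Subgroup G where
  carrier := {g | ∃ x : S1, (g : S1 ≃ₜ S1) x = x}
  mul_mem' := by
    rintro f g hf hg
    obtain ⟨x, hfx, hgx⟩ := exists_common_fixedPoint hG hfree f.2 g.2 hf hg
    exact ⟨x, by rw [Subgroup.coe_mul, Homeomorph.mul_apply, hgx, hfx]⟩
  one_mem' := ⟨0, rfl⟩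
  inv_mem' := by
    rintro f ⟨x, hx⟩
    exact ⟨x, (Homeomorph.symm_apply_eq _).2 hx.symm⟩

variable (hG : G ≤ HomeoPlusCircle) (hfree : NoNonabelianFreeSubgroups G)

lemma mem_fixedPointSubgroup {g : G} :
    g ∈ fixedPointSubgroup hG hfree ↔ ∃ x : S1, (g : S1 ≃ₜ S1) x = x := Iff.rfl

instance normal_fixedPointSubgroup : (fixedPointSubgroup hG hfree).Normal where
  conj_mem := by
    rintro n ⟨x, hx⟩ g
    refine ⟨(g : S1 ≃ₜ S1) x, ?_⟩
    change (g : S1 ≃ₜ S1) ((n : S1 ≃ₜ S1) ((g : S1 ≃ₜ S1).symm ((g : S1 ≃ₜ S1) x))) = _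
    rw [Homeomorph.symm_apply_apply, hx]

lemma exists_isLift_fixing {f : S1 ≃ₜ S1} (hf : f ∈ HomeoPlusCircle) {x : ℝ}
    (hx : f (x : S1) = x) : ∃ F, IsLift F f ∧ F x = x :=
  (exists_isLift hf).choose_spec.exists_apply_eq hx

/-- The lifts with fixed points of the elements with fixed points form a group. An element of it
moves each point by less than `1`, so its orbits are bounded, and the supremum of an orbit is a
common fixed point. -/
lemma globalFix_fixedPointSubgroup_nonempty :
    (globalFix (fixedPointSubgroup hG hfree)).Nonempty := by
  let L : Set CircleDeg1Liftˣ := {F | (∃ y, F y = y) ∧ ∃ g ∈ G, IsLift F g}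
  have hmul : ∀ F ∈ L, ∀ K ∈ L, F * K ∈ L := by
    rintro F ⟨⟨y, hy⟩, f, hf, hF⟩ K ⟨⟨z, hz⟩, g, hg, hK⟩
    obtain ⟨x, hfx, hgx⟩ := exists_common_fixedPoint hG hfree hf hg
      ⟨y, by rw [← hF, hy]⟩ ⟨z, by rw [← hK, hz]⟩
    obtain ⟨x, rfl⟩ := QuotientAddGroup.mk_surjective x
    refine ⟨⟨x, ?_⟩, f * g, G.mul_mem hf hg, hF.mul hK⟩
    rw [CircleDeg1Lift.units_mul_apply, hK.apply_eq_self hz hgx, hF.apply_eq_self hy hfx]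
  have hinv : ∀ F ∈ L, F⁻¹ ∈ L := by
    rintro F ⟨⟨y, hy⟩, f, hf, hF⟩
    refine ⟨⟨y, ?_⟩, f⁻¹, G.inv_mem hf, hF.inv⟩
    conv_lhs => rw [← hy]
    exact CircleDeg1Lift.units_inv_apply_apply F y
  let S : Set ℝ := (fun F : CircleDeg1Liftˣ => F 0) '' L
  have hbdd : BddAbove S := by
    refine ⟨1, ?_⟩
    rintro _ ⟨F, ⟨hF, -⟩, rfl⟩
    have := F.1.map_lt_add_translationNumber_add_one 0
    rw [(CircleDeg1Lift.translationNumber_eq_zero_iff F).2 hF] at this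
    linarith
  have hne : S.Nonempty := ⟨0, 1, ⟨⟨0, rfl⟩, 1, G.one_mem, IsLift.one⟩, rfl⟩
  have hle : ∀ K ∈ L, sSup S ≤ K (sSup S) := by
    intro K hK
    refine csSup_le hne ?_
    rintro _ ⟨F, hF, rfl⟩
    have h := le_csSup hbdd (mem_image_of_mem (fun F : CircleDeg1Liftˣ => F 0)
      (hmul _ (hinv K hK) _ hF))
    have h' := (CircleDeg1Lift.units_strictMono K).monotone h
    simp only [CircleDeg1Lift.units_mul_apply] at h'
    rwa [CircleDeg1Lift.units_apply_inv_apply] at h'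
  refine ⟨(sSup S : ℝ), fun g hg => ?_⟩
  obtain ⟨x, hx⟩ := hg
  obtain ⟨x, rfl⟩ := QuotientAddGroup.mk_surjective x
  obtain ⟨K, hK, hKx⟩ := exists_isLift_fixing (hG g.2) hx
  have hKL : K ∈ L := ⟨⟨x, hKx⟩, g, g.2, hK⟩
  rw [← hK, le_antisymm ?_ (hle K hKL)]
  have h := (CircleDeg1Lift.units_strictMono K).monotone (hle _ (hinv K hKL))
  rwa [CircleDeg1Lift.units_apply_inv_apply] at h

/-- The rotation number, i.e. the translation number of any lift modulo `1`, is a homomorphism on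
`G`, and its kernel consists of the elements with fixed points. -/
lemma exists_rotationHom :
    ∃ ρ : G →* Multiplicative UnitAddCircle, ρ.ker = fixedPointSubgroup hG hfree := by
  obtain ⟨s, hs⟩ := globalFix_fixedPointSubgroup_nonempty hG hfree
  obtain ⟨s, rfl⟩ := QuotientAddGroup.mk_surjective s
  let Γ : Subgroup CircleDeg1Liftˣ :=
    { carrier := {F | ∃ g ∈ G, IsLift F g}
      mul_mem' := by
        rintro F K ⟨f, hf, hF⟩ ⟨g, hg, hK⟩
        exact ⟨f * g, G.mul_mem hf hg, hF.mul hK⟩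
      one_mem' := ⟨1, G.one_mem, IsLift.one⟩
      inv_mem' := by
        rintro F ⟨f, hf, hF⟩
        exact ⟨f⁻¹, G.inv_mem hf, hF.inv⟩ }
  have hadd : ∀ F ∈ Γ, ∀ K ∈ Γ, CircleDeg1Lift.translationNumber (F * K : CircleDeg1Liftˣ) =
      CircleDeg1Lift.translationNumber F + CircleDeg1Lift.translationNumber K := by
    refine fun F hF K hK => CircleDeg1Lift.translationNumber_mul_of_fix Γ s ?_ hF hK
    rintro F ⟨g, hg, hF⟩ ⟨y, hy⟩
    exact hF.apply_eq_self hy (hs ⟨g, hg⟩ ⟨y, by rw [← hF, hy]⟩)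
  choose lift hlift using fun g : G => exists_isLift (hG g.2)
  have hΓ : ∀ g, lift g ∈ Γ := fun g => ⟨g, g.2, hlift g⟩
  have hmul : ∀ f g : G, (CircleDeg1Lift.translationNumber (lift (f * g)) : UnitAddCircle) =
      (CircleDeg1Lift.translationNumber (lift f) : UnitAddCircle) +
        (CircleDeg1Lift.translationNumber (lift g) : UnitAddCircle) := by
    intro f g
    have h1 : IsLift (lift (f * g) * (lift f * lift g)⁻¹) 1 := by
      have := (hlift (f * g)).mul ((hlift f).mul (hlift g)).inv
      rwa [Subgroup.coe_mul, mul_inv_cancel] at this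
    obtain ⟨m, hm⟩ := h1.exists_int_of_one 0
    have h2 := CircleDeg1Lift.translationNumber_of_eq_add_int _ hm
    rw [hadd _ (hΓ _) _ (Γ.inv_mem (Γ.mul_mem (hΓ f) (hΓ g))),
      CircleDeg1Lift.translationNumber_units_inv, hadd _ (hΓ f) _ (hΓ g)] at h2
    rw [← AddCircle.coe_add, coe_eq_coe_iff_exists_int]
    exact ⟨m, by linarith⟩
  refine ⟨MonoidHom.mk' (fun g => Multiplicative.ofAdd
    (CircleDeg1Lift.translationNumber (lift g) : UnitAddCircle)) hmul, ?_⟩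
  ext g
  rw [MonoidHom.mem_ker, mem_fixedPointSubgroup]
  change ((CircleDeg1Lift.translationNumber (lift g) : ℝ) : UnitAddCircle) = ((0 : ℝ) : S1) ↔ _
  rw [coe_eq_coe_iff_exists_int]
  have hint := fun m : ℤ => CircleDeg1Lift.translationNumber_eq_int_iff
    (lift g : CircleDeg1Lift) (CircleDeg1Lift.units_continuous (lift g)) (m := m)
  constructor
  · rintro ⟨m, hm⟩
    rw [zero_add, hint] at hm
    obtain ⟨x, hx⟩ := hm
    exact ⟨x, by rw [← hlift, coe_eq_coe_iff_exists_int]; exact ⟨m, hx⟩⟩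
  · rintro ⟨x, hx⟩
    obtain ⟨x, rfl⟩ := QuotientAddGroup.mk_surjective x
    obtain ⟨m, hm⟩ := coe_eq_coe_iff_exists_int.1 ((hlift g x).trans hx)
    exact ⟨m, by rw [zero_add, hint]; exact ⟨x, hm⟩⟩

end

/-! ### Connected components of open subsets of the circle -/

lemma coe_add_int (x : ℝ) (m : ℤ) : ((x + m : ℝ) : S1) = x :=
  coe_eq_coe_iff_exists_int.2 ⟨m, rfl⟩

lemma continuous_coe_circle : Continuous fun t : ℝ => (t : S1) := AddCircle.continuous_mk' 1

lemma IsOpenArc.isOpen {I : Set S1} (hI : IsOpenArc I) : IsOpen I := by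
  obtain ⟨a, b, -, -, rfl⟩ := hI
  exact QuotientAddGroup.isOpenMap_coe _ isOpen_Ioo

/-- The maximal interval around a point of a proper open subset of the circle, on the line. -/
lemma exists_maximal_Ioo {U : Set S1} (hU : IsOpen U) (hne : U ≠ univ) {x : ℝ} (hx : (x : S1) ∈ U) :
    ∃ a b : ℝ, a < x ∧ x < b ∧ b ≤ a + 1 ∧ (a : S1) ∉ U ∧ (b : S1) ∉ U ∧
      ∀ t ∈ Ioo a b, (t : S1) ∈ U := by
  let L : Set ℝ := (fun t : ℝ => (t : S1)) ⁻¹' Uᶜ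
  have hL : IsClosed L := hU.isClosed_compl.preimage continuous_coe_circle
  have hxL : x ∉ L := fun h => h hx
  obtain ⟨c, hc⟩ := (ne_univ_iff_exists_notMem U).1 hne
  obtain ⟨c, rfl⟩ := QuotientAddGroup.mk_surjective c
  have hcL : ∀ m : ℤ, c + m ∈ L := fun m => by
    change ((c + m : ℝ) : S1) ∉ U
    rwa [coe_add_int]
  have h1 := Int.floor_le (x - c)
  have h2 := Int.le_ceil (x - c)
  have h3 := Int.lt_floor_add_one (x - c)
  have hA : (L ∩ Iic x).Nonempty := ⟨c + ⌊x - c⌋, hcL _, by rw [mem_Iic]; linarith⟩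
  have hB : (L ∩ Ici x).Nonempty := ⟨c + ⌈x - c⌉, hcL _, by rw [mem_Ici]; linarith⟩
  have hAb : BddAbove (L ∩ Iic x) := ⟨x, fun t ht => ht.2⟩
  have hBb : BddBelow (L ∩ Ici x) := ⟨x, fun t ht => ht.2⟩
  have ha := (hL.inter isClosed_Iic).csSup_mem hA hAb
  have hb := (hL.inter isClosed_Ici).csInf_mem hB hBb
  refine ⟨sSup (L ∩ Iic x), sInf (L ∩ Ici x), lt_of_le_of_ne ha.2 fun h => hxL (h ▸ ha.1),
    lt_of_le_of_ne hb.2 fun h => hxL (h ▸ hb.1), csInf_le hBb ⟨?_, ?_⟩, ha.1, hb.1, fun t ht => ?_⟩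
  · have := coe_add_int (sSup (L ∩ Iic x)) 1
    rw [Int.cast_one] at this
    change ((sSup (L ∩ Iic x) + 1 : ℝ) : S1) ∉ U
    rw [this]
    exact ha.1
  · have := le_csSup hAb ⟨hcL ⌊x - c⌋, by rw [mem_Iic]; linarith⟩
    rw [mem_Ici]
    linarith
  · by_contra htU
    rcases le_total t x with h | h
    · exact absurd (le_csSup hAb ⟨htU, h⟩) (not_le.2 ht.1)
    · exact absurd (csInf_le hBb ⟨htU, h⟩) (not_le.2 ht.2)

lemma connectedComponentIn_eq_image_Ioo {U : Set S1} {a b x : ℝ} (hax : a < x) (hxb : x < b)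
    (ha : (a : S1) ∉ U) (hb : (b : S1) ∉ U) (hab : ∀ t ∈ Ioo a b, (t : S1) ∈ U) :
    connectedComponentIn U (x : S1) = (fun t : ℝ => (t : S1)) '' Ioo a b := by
  have hsub : (fun t : ℝ => (t : S1)) '' Ioo a b ⊆ U := by
    rintro _ ⟨t, ht, rfl⟩
    exact hab t ht
  apply Subset.antisymm
  · -- the image of `(a, b)` is clopen in `U`, since the image of `[a, b]` is compact
    refine isPreconnected_connectedComponentIn.subset_left_of_subset_union
      (u := (fun t : ℝ => (t : S1)) '' Ioo a b) (v := ((fun t : ℝ => (t : S1)) '' Icc a b)ᶜ)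
      (QuotientAddGroup.isOpenMap_coe _ isOpen_Ioo)
      (isCompact_Icc.image continuous_coe_circle).isClosed.isOpen_compl
      (disjoint_compl_right_iff_subset.2 (image_mono Ioo_subset_Icc_self)) ?_
      ⟨x, mem_connectedComponentIn (hab x ⟨hax, hxb⟩), x, ⟨hax, hxb⟩, rfl⟩
    intro y hy
    by_cases h : y ∈ (fun t : ℝ => (t : S1)) '' Icc a b
    · obtain ⟨t, ht, rfl⟩ := h
      have htU := connectedComponentIn_subset U _ hy
      exact Or.inl ⟨t, ⟨lt_of_le_of_ne ht.1 fun h => ha (h ▸ htU),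
        lt_of_le_of_ne ht.2 fun h => hb (h ▸ htU)⟩, rfl⟩
    · exact Or.inr h
  · exact (isPreconnected_Ioo.image _ continuous_coe_circle.continuousOn).subset_connectedComponentIn
      ⟨x, ⟨hax, hxb⟩, rfl⟩ hsub

lemma isOpenArc_connectedComponentIn {U : Set S1} (hU : IsOpen U) (hne : U ≠ univ) {x : S1}
    (hx : x ∈ U) : IsOpenArc (connectedComponentIn U x) := by
  obtain ⟨x, rfl⟩ := QuotientAddGroup.mk_surjective x
  obtain ⟨a, b, hax, hxb, hba, ha, hb, hab⟩ := exists_maximal_Ioo hU hne hx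
  exact ⟨a, b, hax.trans hxb, hba, connectedComponentIn_eq_image_Ioo hax hxb ha hb hab⟩

/-- An orientation-preserving homeomorphism that preserves `U` and a component of `U` fixes the
endpoints of the component. -/
lemma exists_fixedPoint_of_mem_connectedComponentIn {U : Set S1} (hU : IsOpen U) (hne : U ≠ univ)
    {g : S1 ≃ₜ S1} (hg : g ∈ HomeoPlusCircle) (hgU : ∀ y, g y ∈ U ↔ y ∈ U) {x : S1} (hx : x ∈ U)
    (hgx : g x ∈ connectedComponentIn U x) : ∃ y, g y = y := by
  obtain ⟨x, rfl⟩ := QuotientAddGroup.mk_surjective x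
  obtain ⟨a, b, hax, hxb, -, ha, hb, hab⟩ := exists_maximal_Ioo hU hne hx
  obtain ⟨t, ht, htx⟩ := (connectedComponentIn_eq_image_Ioo hax hxb ha hb hab).le hgx
  obtain ⟨F₀, hF₀⟩ := exists_isLift hg
  obtain ⟨F, hF, hFx⟩ := hF₀.exists_apply_eq (x := x) (y := t) htx.symm
  have hmono := CircleDeg1Lift.units_strictMono F
  have hmono' := CircleDeg1Lift.units_strictMono F⁻¹
  have hFU : ∀ y : ℝ, ((F y : ℝ) : S1) ∈ U ↔ (y : S1) ∈ U := fun y => by rw [hF y, hgU]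
  have h1 : F a ≤ a := by
    by_contra! h
    exact ha ((hFU a).1 (hab _ ⟨h, ((hmono hax).trans_eq hFx).trans ht.2⟩))
  have h2 : F⁻¹ a ≤ a := by
    by_contra! h
    have h3 : F⁻¹ a < b := by
      have := hmono' ht.1
      rw [← hFx, CircleDeg1Lift.units_inv_apply_apply] at this
      exact this.trans hxb
    have h4 := (hFU _).2 (hab _ ⟨h, h3⟩)
    rw [CircleDeg1Lift.units_apply_inv_apply] at h4
    exact ha h4
  have h3 := hmono.monotone h2
  rw [CircleDeg1Lift.units_apply_inv_apply] at h3
  exact ⟨(a : S1), by rw [← hF a, le_antisymm h1 h3]⟩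

lemma mem_iff_of_fix_compl {α : Type*} {U : Set α} (g : α ≃ α) (h : ∀ y ∉ U, g y = y) (y : α) :
    g y ∈ U ↔ y ∈ U := by
  constructor
  · intro hy
    by_contra hyU
    rw [h y hyU] at hy
    exact hyU hy
  · intro hy
    by_contra hyU
    rw [g.injective (h _ hyU)] at hyU
    exact hyU hy

/-- An orientation-preserving homeomorphism that fixes all points outside `U` maps every component
of `U` to itself. -/
lemma mem_connectedComponentIn_iff_of_fix_compl {U : Set S1} (hU : IsOpen U) (hne : U ≠ univ)
    {g : S1 ≃ₜ S1} (hg : g ∈ HomeoPlusCircle) (hfix : ∀ y ∉ U, g y = y) (x y : S1)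
    : g y ∈ connectedComponentIn U x ↔ y ∈ connectedComponentIn U x := by
  have key : ∀ y ∈ U, g y ∈ connectedComponentIn U y := by
    intro y hy
    obtain ⟨y, rfl⟩ := QuotientAddGroup.mk_surjective y
    obtain ⟨a, b, hay, hyb, -, ha, hb, hab⟩ := exists_maximal_Ioo hU hne hy
    obtain ⟨F, hF, hFa⟩ := exists_isLift_fixing hg (hfix a ha)
    have hFb := hF.apply_eq_self hFa (hfix b hb)
    have hmono := CircleDeg1Lift.units_strictMono F
    refine (connectedComponentIn_eq_image_Ioo hay hyb ha hb hab).ge ⟨F y, ⟨?_, ?_⟩, hF y⟩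
    · exact hFa.ge.trans_lt (hmono hay)
    · exact (hmono hyb).trans_eq hFb
  constructor
  · intro h
    have hyU := (mem_iff_of_fix_compl g.toEquiv hfix y).1 (connectedComponentIn_subset _ _ h)
    rw [connectedComponentIn_eq h, ← connectedComponentIn_eq (key y hyU)]
    exact mem_connectedComponentIn hyU
  · intro h
    rw [connectedComponentIn_eq h]
    exact key y (connectedComponentIn_subset _ _ h)

/-! ### Orientation-preserving homeomorphisms and the cyclic order -/

lemma sbtw_coe_iff {a b c : ℝ} : sbtw (a : S1) (b : S1) (c : S1) ↔
    ∃ m k : ℤ, c < a + m ∧ a + m < b + k ∧ b + k < c + 1 := by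
  have hp := (zero_lt_one : (0 : ℝ) < 1)
  rw [sbtw_iff_not_btw]
  refine (not_congr QuotientAddGroup.btw_coe_iff).trans ?_
  rw [not_le]
  constructor
  · intro h
    refine ⟨-toIocDiv hp c a, -toIcoDiv hp c b, ?_, ?_, ?_⟩
    · have := left_lt_toIocMod hp c a
      rw [toIocMod] at this
      simp at this ⊢
      linarith
    · rw [toIocMod, toIcoMod] at h
      simp at h ⊢
      linarith
    · have := toIcoMod_lt_right hp c b
      rw [toIcoMod] at this
      simp at this ⊢
      linarith
  · rintro ⟨m, k, h1, h2, h3⟩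
    have ha : toIocMod hp c a = a + m :=
      (toIocMod_eq_iff hp).2 ⟨⟨h1, by linarith⟩, -m, by simp⟩
    have hb : toIcoMod hp c b = b + k :=
      (toIcoMod_eq_iff hp).2 ⟨⟨by linarith, h3⟩, -k, by simp⟩
    rwa [ha, hb]

lemma sbtw_map_of_mem_homeoPlusCircle {f : S1 ≃ₜ S1} (hf : f ∈ HomeoPlusCircle) {x y z : S1}
    (h : sbtw x y z) : sbtw (f x) (f y) (f z) := by
  obtain ⟨x, rfl⟩ := QuotientAddGroup.mk_surjective x
  obtain ⟨y, rfl⟩ := QuotientAddGroup.mk_surjective y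
  obtain ⟨z, rfl⟩ := QuotientAddGroup.mk_surjective z
  obtain ⟨F, hF⟩ := exists_isLift hf
  obtain ⟨m, k, h1, h2, h3⟩ := sbtw_coe_iff.1 h
  have hmono := CircleDeg1Lift.units_strictMono F
  have := sbtw_coe_iff.2 ⟨m, k, by simpa using hmono h1, by simpa using hmono h2,
    by simpa using hmono h3⟩
  rwa [hF, hF, hF] at this

lemma sbtw_map_iff_of_mem_homeoPlusCircle {f : S1 ≃ₜ S1} (hf : f ∈ HomeoPlusCircle) (x y z : S1) :
    sbtw (f x) (f y) (f z) ↔ sbtw x y z := by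
  refine ⟨fun h => ?_, sbtw_map_of_mem_homeoPlusCircle hf⟩
  simpa using sbtw_map_of_mem_homeoPlusCircle (HomeoPlusCircle.inv_mem hf) h

/-! ### Quotients, free subgroups and wreath products -/

lemma exists_addSubgroup_mulEquiv_quotient {Γ A : Type*} [Group Γ] [AddCommGroup A]
    (ρ : Γ →* Multiplicative A) {N : Subgroup Γ} [N.Normal] (h : ρ.ker = N) :
    ∃ K : AddSubgroup A, Nonempty (Γ ⧸ N ≃* Multiplicative K) := by
  refine ⟨ρ.range.toAddSubgroup', ⟨(QuotientGroup.quotientMulEquivOfEq h.symm).trans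
    ((QuotientGroup.quotientKerEquivRange ρ).trans ?_)⟩⟩
  exact
    { toFun := fun x => Multiplicative.ofAdd ⟨x.1.toAdd, x.2⟩
      invFun := fun x => ⟨Multiplicative.ofAdd x.toAdd.1, x.toAdd.2⟩
      left_inv := fun _ => rfl
      right_inv := fun _ => rfl
      map_mul' := fun _ _ => rfl }

/-- A free subgroup of a quotient lifts, so quotients of subgroups inherit the absence of
non-abelian free subgroups. -/
lemma NoNonabelianFreeSubgroups.of_surjective {Γ Δ : Type*} [Group Γ] [Group Δ]
    (hΓ : NoNonabelianFreeSubgroups Γ) {N : Subgroup Γ} (r : N →* Δ)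
    (hr : Function.Surjective r) : NoNonabelianFreeSubgroups Δ := by
  intro K hK a ha b hb
  let σ : K →* N := IsFreeGroup.lift fun i => Function.surjInv hr (IsFreeGroup.of i : K)
  have hσ : ∀ k, r (σ k) = k := by
    have : r.comp σ = K.subtype := by
      refine IsFreeGroup.ext_hom fun i => ?_
      simp only [MonoidHom.comp_apply, σ, IsFreeGroup.lift_of]
      exact Function.surjInv_eq hr _
    exact fun k => DFunLike.congr_fun this k
  have hinj : Function.Injective (N.subtype.comp σ) := fun k l h => by
    have := congrArg r (Subtype.ext h : σ k = σ l)
    rw [hσ, hσ] at this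
    exact Subtype.ext this
  have hcomm := hΓ _ (IsFreeGroup.ofMulEquiv (MonoidHom.ofInjective hinj)) _ ⟨⟨a, ha⟩, rfl⟩ _
    ⟨⟨b, hb⟩, rfl⟩
  have h := congrArg r (Subtype.ext hcomm : σ ⟨a, ha⟩ * σ ⟨b, hb⟩ = σ ⟨b, hb⟩ * σ ⟨a, ha⟩)
  rwa [map_mul, map_mul, hσ, hσ] at h

/-- The Kaluzhnin–Krasner embedding, for a homomorphism `r` on the normal subgroup `N` whose kernel
contains no nontrivial element together with all its conjugates. -/
lemma exists_injective_hom_regularWreathProduct {Γ H : Type*} [Group Γ] [Group H] {N : Subgroup Γ}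
    [N.Normal] (r : N →* H)
    (hr : ∀ n : N, (∀ g : Γ, r ⟨g⁻¹ * n * g,
      by simpa using Subgroup.Normal.conj_mem inferInstance n.1 n.2 g⁻¹⟩ = 1) → n = 1) :
    ∃ φ : Γ →* H ≀ᵣ (Γ ⧸ N), Function.Injective φ := by
  have hout : ∀ t : Γ ⧸ N, ((t.out : Γ) : Γ ⧸ N) = t := fun t => QuotientGroup.out_eq' t
  have hmem : ∀ (g : Γ) (t : Γ ⧸ N), t.out⁻¹ * g * ((g : Γ ⧸ N)⁻¹ * t).out ∈ N := by
    intro g t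
    rw [← QuotientGroup.eq_one_iff]
    simp [hout]
  let φ : Γ →* H ≀ᵣ (Γ ⧸ N) := MonoidHom.mk'
    (fun g => ⟨fun t => r ⟨t.out⁻¹ * g * ((g : Γ ⧸ N)⁻¹ * t).out, hmem g t⟩, g⟩) <| by
      intro g h
      refine RegularWreathProduct.ext (funext fun t => ?_) rfl
      simp only [RegularWreathProduct.mul_left, Pi.mul_apply, ← map_mul]
      congr 1
      refine Subtype.ext ?_
      simp only [Subgroup.coe_mul, QuotientGroup.mk_mul, mul_inv_rev, mul_assoc,
        mul_inv_cancel_left]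
  refine ⟨φ, (injective_iff_map_eq_one φ).2 fun n hn => ?_⟩
  have hnN : n ∈ N := (QuotientGroup.eq_one_iff n).1 (congrArg RegularWreathProduct.right hn)
  refine congrArg Subtype.val (hr ⟨n, hnN⟩ fun g => ?_)
  have h1 := congrFun (congrArg RegularWreathProduct.left hn) (g : Γ ⧸ N)
  simp only [RegularWreathProduct.one_left, Pi.one_apply] at h1
  have hgm : (g : Γ ⧸ N).out⁻¹ * g ∈ N := by
    rw [← QuotientGroup.eq_one_iff]
    simp [hout]
  -- `g` differs from the chosen representative of its coset by an element `m` of `N`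
  set m : N := ⟨(g : Γ ⧸ N).out⁻¹ * g, hgm⟩ with hm
  have h2 : r ⟨(g : Γ ⧸ N).out⁻¹ * n * ((n : Γ ⧸ N)⁻¹ * (g : Γ ⧸ N)).out, hmem n g⟩ = 1 := h1
  have h3 : (⟨g⁻¹ * n * g, by simpa using Subgroup.Normal.conj_mem inferInstance n hnN g⁻¹⟩ : N) =
      m⁻¹ * ⟨(g : Γ ⧸ N).out⁻¹ * n * ((n : Γ ⧸ N)⁻¹ * (g : Γ ⧸ N)).out, hmem n g⟩ * m := by
    refine Subtype.ext ?_
    have h4 : ((n : Γ ⧸ N)⁻¹ * (g : Γ ⧸ N)) = g := by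
      rw [(QuotientGroup.eq_one_iff n).2 hnN, inv_one, one_mul]
    simp only [h4, hm, Subgroup.coe_mul, Subgroup.coe_inv]
    group
  rw [h3, map_mul, map_mul, h2, map_inv, mul_one, inv_mul_cancel]

/-! ### The complement of an orbit closure and its components -/

section

variable {G : Subgroup (S1 ≃ₜ S1)}

lemma isOpen_orbitClosureCompl (s : S1) : IsOpen (orbitClosureCompl G s) :=
  isClosed_closure.isOpen_compl

lemma orbitClosureCompl_ne_univ (s : S1) : orbitClosureCompl G s ≠ univ :=
  (ne_univ_iff_exists_notMem _).2 ⟨s, not_not.2 (subset_closure ⟨1, G.one_mem, rfl⟩)⟩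

lemma map_mem_orbitClosureCompl_iff {g : S1 ≃ₜ S1} (hg : g ∈ G) (s x : S1) :
    g x ∈ orbitClosureCompl G s ↔ x ∈ orbitClosureCompl G s := by
  have himg : g '' {x : S1 | ∃ g ∈ G, g s = x} = {x : S1 | ∃ g ∈ G, g s = x} := by
    ext y
    constructor
    · rintro ⟨_, ⟨f, hf, rfl⟩, rfl⟩
      exact ⟨g * f, G.mul_mem hg hf, rfl⟩
    · rintro ⟨f, hf, rfl⟩
      exact ⟨(g⁻¹ * f) s, ⟨g⁻¹ * f, G.mul_mem (G.inv_mem hg) hf, rfl⟩, g.apply_symm_apply _⟩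
  have hcl := g.image_closure {x : S1 | ∃ g ∈ G, g s = x}
  rw [himg] at hcl
  refine not_congr ?_
  conv_lhs => rw [← hcl]
  exact g.injective.mem_set_image

lemma image_orbitClosureCompl {g : S1 ≃ₜ S1} (hg : g ∈ G) (s : S1) :
    g '' orbitClosureCompl G s = orbitClosureCompl G s := by
  ext y
  obtain ⟨x, rfl⟩ := g.surjective y
  rw [g.injective.mem_set_image, map_mem_orbitClosureCompl_iff hg]

/-- By normality, the common fixed points of `N` form a closed set that is invariant
under `G`, so it contains the closure of the orbit of `s`. -/
lemma eq_self_of_notMem_orbitClosureCompl {N : Subgroup G} [N.Normal] {s : S1}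
    (hs : s ∈ globalFix N) {x : S1} (hx : x ∉ orbitClosureCompl G s) {n : G} (hn : n ∈ N) :
    (n : S1 ≃ₜ S1) x = x := by
  have hsub : closure {x : S1 | ∃ g ∈ G, g s = x} ⊆ {x | (n : S1 ≃ₜ S1) x = x} := by
    refine closure_minimal ?_ (isClosed_eq (n : S1 ≃ₜ S1).continuous continuous_id)
    rintro _ ⟨g, hg, rfl⟩
    have h := hs _ (Subgroup.Normal.conj_mem' inferInstance n hn ⟨g, hg⟩)
    change g.symm ((n : S1 ≃ₜ S1) (g s)) = s at h
    exact (g.symm_apply_eq).1 h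
  exact hsub (not_not.1 hx)

lemma image_component_orbitClosureCompl {g : S1 ≃ₜ S1} (hg : g ∈ G) {s x : S1}
    (hx : x ∈ orbitClosureCompl G s) :
    g '' connectedComponentIn (orbitClosureCompl G s) x =
      connectedComponentIn (orbitClosureCompl G s) (g x) := by
  rw [g.image_connectedComponentIn hx, image_orbitClosureCompl hg]

/-- If two translates of a component of the complement of the orbit closure meet, they are equal, so
the quotient of the two elements preserves a component and fixes its endpoints. Hence `G / N` acts
freely on the components if `N` contains the elements with fixed points. -/
lemma mk_eq_mk_of_image_component_inter {N : Subgroup G}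
    (hG : G ≤ HomeoPlusCircle) (hN : ∀ g : G, (∃ x : S1, (g : S1 ≃ₜ S1) x = x) → g ∈ N) {s x : S1}
    (hx : x ∈ orbitClosureCompl G s) {g h : G}
    (hgh : ¬ Disjoint ((g : S1 ≃ₜ S1) '' connectedComponentIn (orbitClosureCompl G s) x)
      ((h : S1 ≃ₜ S1) '' connectedComponentIn (orbitClosureCompl G s) x)) :
    (g : G ⧸ N) = (h : G ⧸ N) := by
  rw [QuotientGroup.eq]
  refine hN _ (exists_fixedPoint_of_mem_connectedComponentIn (isOpen_orbitClosureCompl s)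
    (orbitClosureCompl_ne_univ s) (hG (g⁻¹ * h).2) (map_mem_orbitClosureCompl_iff (g⁻¹ * h).2 s)
    hx ?_)
  rw [image_component_orbitClosureCompl g.2 hx, image_component_orbitClosureCompl h.2 hx] at hgh
  obtain ⟨y, hy1, hy2⟩ := not_disjoint_iff.1 hgh
  have h1 : (h : S1 ≃ₜ S1) x ∈ (g : S1 ≃ₜ S1) '' connectedComponentIn (orbitClosureCompl G s) x := by
    rw [image_component_orbitClosureCompl g.2 hx, connectedComponentIn_eq hy1,
      ← connectedComponentIn_eq hy2]
    exact mem_connectedComponentIn ((map_mem_orbitClosureCompl_iff h.2 s x).2 hx)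
  obtain ⟨z, hz, hzx⟩ := h1
  have : ((g⁻¹ * h : G) : S1 ≃ₜ S1) x = z := (g : S1 ≃ₜ S1).symm_apply_eq.2 hzx.symm
  rwa [this]

/-- One component from each `G`-orbit of components gives a fundamental family. -/
lemma exists_isFundamentalFamily {N : Subgroup G} (hG : G ≤ HomeoPlusCircle)
    (hN : ∀ g : G, (∃ x : S1, (g : S1 ≃ₜ S1) x = x) → g ∈ N) (s : S1) :
    ∃ 𝓘 : Set (Set S1), IsFundamentalFamily N s 𝓘 := by
  set U := orbitClosureCompl G s with hU
  -- two points are equivalent if some element of `G` maps one into the component of the other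
  let R : Setoid U :=
    { r := fun x y => ∃ g ∈ G, g x ∈ connectedComponentIn U (y : S1)
      iseqv := by
        refine ⟨fun x => ⟨1, G.one_mem, mem_connectedComponentIn x.2⟩, ?_, ?_⟩
        · rintro x y ⟨g, hg, h⟩
          have h1 : (y : S1) ∈ g '' connectedComponentIn U (x : S1) := by
            rw [image_component_orbitClosureCompl hg x.2, ← connectedComponentIn_eq h]
            exact mem_connectedComponentIn y.2
          obtain ⟨z, hz, hzy⟩ := h1
          exact ⟨g⁻¹, G.inv_mem hg, by rwa [Homeomorph.inv_apply, g.symm_apply_eq.2 hzy.symm]⟩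
        · rintro x y z ⟨g, hg, h⟩ ⟨f, hf, h'⟩
          refine ⟨f * g, G.mul_mem hf hg, ?_⟩
          have h1 := mem_image_of_mem f h
          rwa [image_component_orbitClosureCompl hf y.2, ← connectedComponentIn_eq h'] at h1 }
  let rep : Quotient R → U := Quotient.out
  refine ⟨range fun c => connectedComponentIn U (rep c : S1), ?_, ?_, ?_⟩
  · rintro _ ⟨c, rfl⟩
    exact ⟨rep c, (rep c).2, rfl⟩
  · intro g h hgh
    rw [disjoint_left]
    rintro _ ⟨x, ⟨_, ⟨c, rfl⟩, hx⟩, rfl⟩ ⟨y, ⟨_, ⟨d, rfl⟩, hy⟩, hxy⟩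
    have hcd : c = d := by
      rw [← Quotient.out_eq c, ← Quotient.out_eq d]
      refine Quotient.sound ⟨(h⁻¹ * g : G), (h⁻¹ * g : G).2, ?_⟩
      have h1 : ((h⁻¹ * g : G) : S1 ≃ₜ S1) x = y := (h : S1 ≃ₜ S1).symm_apply_eq.2 hxy.symm
      have h2 := mem_image_of_mem ((h⁻¹ * g : G) : S1 ≃ₜ S1) hx
      rw [image_component_orbitClosureCompl (h⁻¹ * g : G).2 (rep c).2, h1] at h2
      change _ ∈ connectedComponentIn U (rep d : S1)
      rw [connectedComponentIn_eq hy, ← connectedComponentIn_eq h2]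
      exact mem_connectedComponentIn
        ((map_mem_orbitClosureCompl_iff (h⁻¹ * g : G).2 s _).2 (rep c).2)
    subst hcd
    exact hgh (mk_eq_mk_of_image_component_inter hG hN (rep c).2
      (not_disjoint_iff.2 ⟨_, ⟨x, hx, rfl⟩, y, hy, hxy⟩))
  · apply Subset.antisymm
    · refine iUnion_subset fun g => ?_
      rintro _ ⟨x, ⟨_, ⟨c, rfl⟩, hx⟩, rfl⟩
      exact (map_mem_orbitClosureCompl_iff g.2 s x).2 (connectedComponentIn_subset _ _ hx)
    · intro x hx
      obtain ⟨g, hg, h⟩ : R.r (rep (Quotient.mk R ⟨x, hx⟩)) ⟨x, hx⟩ :=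
        Quotient.exact (Quotient.out_eq (Quotient.mk R ⟨x, hx⟩))
      have h1 : x ∈ g '' connectedComponentIn U (rep (Quotient.mk R ⟨x, hx⟩) : S1) := by
        rw [image_component_orbitClosureCompl hg (rep _).2, ← connectedComponentIn_eq h]
        exact mem_connectedComponentIn hx
      exact mem_iUnion.2 ⟨⟨g, hg⟩, image_mono (subset_sUnion_of_mem (mem_range_self _)) h1⟩

/-- `G / N` is countable if `N` is nontrivial, since its translates of a component are disjoint. -/
lemma countable_quotient {N : Subgroup G} [N.Normal] (hG : G ≤ HomeoPlusCircle)
    (hN : ∀ g : G, (∃ x : S1, (g : S1 ≃ₜ S1) x = x) → g ∈ N) {s : S1} (hs : s ∈ globalFix N)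
    (hne : N ≠ ⊥) : Countable (G ⧸ N) := by
  obtain ⟨n, hn, hn1⟩ := N.bot_or_exists_ne_one.resolve_left hne
  obtain ⟨x, hx⟩ : ∃ x, (n : S1 ≃ₜ S1) x ≠ x := by
    by_contra! h
    exact hn1 (Subtype.ext (Homeomorph.ext h))
  have hxU : x ∈ orbitClosureCompl G s := by
    by_contra h
    exact hx (eq_self_of_notMem_orbitClosureCompl hs h hn)
  refine Pairwise.countable_of_isOpen_disjoint (s := fun t : G ⧸ N =>
    (t.out : S1 ≃ₜ S1) '' connectedComponentIn (orbitClosureCompl G s) x) (fun t u htu => ?_)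
    (fun t => (t.out : S1 ≃ₜ S1).isOpenMap _ (isOpenArc_connectedComponentIn (isOpen_orbitClosureCompl s)
      (orbitClosureCompl_ne_univ s) hxU).isOpen)
    (fun t => ⟨_, x, mem_connectedComponentIn hxU, rfl⟩)
  by_contra h
  have := mk_eq_mk_of_image_component_inter hG hN hxU h
  rw [QuotientGroup.out_eq', QuotientGroup.out_eq'] at this
  exact htu this

lemma IsFundamentalFamily.countable {N : Subgroup G} {s : S1} {𝓘 : Set (Set S1)}
    (h𝓘 : IsFundamentalFamily N s 𝓘) : 𝓘.Countable := by
  refine PairwiseDisjoint.countable_of_isOpen (s := id) ?_ ?_ ?_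
  · intro I hI J hJ hIJ
    obtain ⟨x, hx, rfl⟩ := h𝓘.isComponent I hI
    obtain ⟨y, hy, rfl⟩ := h𝓘.isComponent J hJ
    refine disjoint_left.2 fun z hz hz' => hIJ ?_
    rw [connectedComponentIn_eq hz, connectedComponentIn_eq hz']
  · intro I hI
    obtain ⟨x, hx, rfl⟩ := h𝓘.isComponent I hI
    exact (isOpenArc_connectedComponentIn (isOpen_orbitClosureCompl s)
      (orbitClosureCompl_ne_univ s) hx).isOpen
  · intro I hI
    obtain ⟨x, hx, rfl⟩ := h𝓘.isComponent I hI
    exact ⟨x, mem_connectedComponentIn hx⟩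

/-! ### Restriction to a fundamental domain -/

lemma IsFundamentalFamily.exists_isRestriction {N : Subgroup G} [N.Normal]
    (hG : G ≤ HomeoPlusCircle) {s : S1} (hs : s ∈ globalFix N) {𝓘 : Set (Set S1)}
    (h𝓘 : IsFundamentalFamily N s 𝓘) {n : G} (hn : n ∈ N) :
    ∃ h : ∀ I : 𝓘, HomeoPlusArc (I : Set S1), IsRestriction (n : S1 ≃ₜ S1) 𝓘 h := by
  have hmem : ∀ (I : 𝓘) (x : S1), x ∈ (I : Set S1) ↔ (n : S1 ≃ₜ S1) x ∈ (I : Set S1) := by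
    rintro ⟨I, hI⟩ x
    obtain ⟨y, hy, rfl⟩ := h𝓘.isComponent I hI
    exact (mem_connectedComponentIn_iff_of_fix_compl (isOpen_orbitClosureCompl s)
      (orbitClosureCompl_ne_univ s) (hG n.2)
      (fun z hz => eq_self_of_notMem_orbitClosureCompl hs hz hn) y x).symm
  exact ⟨fun I => ⟨(n : S1 ≃ₜ S1).subtype (hmem I), fun x y z =>
    sbtw_map_iff_of_mem_homeoPlusCircle (hG n.2) _ _ _⟩, fun I x => rfl⟩

lemma IsRestriction.unique {g : S1 ≃ₜ S1} {𝓘 : Set (Set S1)}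
    {h k : ∀ I : 𝓘, HomeoPlusArc (I : Set S1)} (hh : IsRestriction g 𝓘 h)
    (hk : IsRestriction g 𝓘 k) : h = k :=
  funext fun I => Subtype.ext (Homeomorph.ext fun x => Subtype.ext ((hh I x).trans (hk I x).symm))

/-- Restriction to the union of `𝓘`, as a homomorphism. -/
lemma exists_restrictionHom {N : Subgroup G} {𝓘 : Set (Set S1)}
    (hres : ∀ n ∈ N, ∃ h : ∀ I : 𝓘, HomeoPlusArc (I : Set S1),
      IsRestriction (n : S1 ≃ₜ S1) 𝓘 h) :
    ∃ r : N →* restrictionGroup N 𝓘, Function.Surjective r ∧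
      ∀ n : N, IsRestriction ((n : G) : S1 ≃ₜ S1) 𝓘 (r n) := by
  choose h hh using fun n : N => hres n n.2
  refine ⟨MonoidHom.mk' (fun n => ⟨h n, n, n.2, hh n⟩) fun m n => Subtype.ext ?_, ?_, hh⟩
  · refine (hh (m * n)).unique fun I x => ?_
    exact (hh m I _).trans (congrArg (m.1 : S1 ≃ₜ S1) (hh n I x))
  · rintro ⟨k, g, hg, hk⟩
    exact ⟨⟨g, hg⟩, Subtype.ext ((hh ⟨g, hg⟩).unique hk)⟩

/-- An element of `N` all of whose conjugates are trivial on the fundamental domain is trivial on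
the translates of the domain, and it fixes all other points anyway. -/
lemma IsFundamentalFamily.eq_one {N : Subgroup G} [N.Normal] {s : S1} (hs : s ∈ globalFix N)
    {𝓘 : Set (Set S1)} (h𝓘 : IsFundamentalFamily N s 𝓘) {n : G} (hn : n ∈ N)
    (h : ∀ g : G, ∀ x ∈ ⋃₀ 𝓘, ((g⁻¹ * n * g : G) : S1 ≃ₜ S1) x = x) : n = 1 := by
  refine Subtype.ext (Homeomorph.ext fun x => ?_)
  by_cases hx : x ∈ orbitClosureCompl G s
  · rw [← h𝓘.cover] at hx
    obtain ⟨g, y, hy, rfl⟩ := mem_iUnion.1 hx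
    exact (g : S1 ≃ₜ S1).symm_apply_eq.1 (h g y hy)
  · exact eq_self_of_notMem_orbitClosureCompl hs hx hn

end

theorem theoremC (G : Subgroup (S1 ≃ₜ S1)) (hG : G ≤ HomeoPlusCircle)
    (hfree : NoNonabelianFreeSubgroups G) :
    (∀ f ∈ G, ∀ g ∈ G, f * g = g * f) ∨
    ∃ (G₀ : Subgroup G) (_ : G₀.Normal),
      -- `G₀` consists of the elements of `G` that have a fixed point
      (∀ g : G, g ∈ G₀ ↔ ∃ x : S1, (g : S1 ≃ₜ S1) x = x) ∧
      -- `T = G / G₀` is isomorphic to a countable subgroup of `ℝ/ℤ`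
      (∃ K : AddSubgroup UnitAddCircle, Countable K ∧
        Nonempty (G ⧸ G₀ ≃* Multiplicative K)) ∧
      -- `G₀` has global fixed points, and for each of them, `s`, there is a fundamental domain
      (globalFix G₀).Nonempty ∧
      ∀ s ∈ globalFix G₀,
        (∃ 𝓘 : Set (Set S1), IsFundamentalFamily G₀ s 𝓘) ∧
        ∀ 𝓘 : Set (Set S1), IsFundamentalFamily G₀ s 𝓘 →
          -- the fundamental domain consists of at most countably many open intervals
          𝓘.Countable ∧ (∀ I ∈ 𝓘, IsOpenArc I) ∧
          -- every element of `G₀` restricts to an element of `∏ Homeo₊(I)`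
          (∀ g ∈ G₀, ∃ h : ∀ I : 𝓘, HomeoPlusArc (I : Set S1),
            IsRestriction (g : S1 ≃ₜ S1) 𝓘 h) ∧
          -- `H₀ = G₀|_D` has no non-abelian free subgroups, and `G` embeds in `H₀ ≀ T`
          NoNonabelianFreeSubgroups (restrictionGroup G₀ 𝓘) ∧
          ∃ φ : G →* (restrictionGroup G₀ 𝓘) ≀ᵣ (G ⧸ G₀), Function.Injective φ := by
  by_cases hab : ∀ f ∈ G, ∀ g ∈ G, f * g = g * f
  · exact Or.inl hab
  refine Or.inr ⟨fixedPointSubgroup hG hfree, inferInstance, fun g => Iff.rfl, ?_,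
    globalFix_fixedPointSubgroup_nonempty hG hfree, fun s hs => ⟨?_, fun 𝓘 h𝓘 => ?_⟩⟩
  · obtain ⟨ρ, hρ⟩ := exists_rotationHom hG hfree
    obtain ⟨K, ⟨e⟩⟩ := exists_addSubgroup_mulEquiv_quotient ρ hρ
    obtain ⟨s, hs⟩ := globalFix_fixedPointSubgroup_nonempty hG hfree
    -- the values of `ρ` commute, so if `ρ` were injective, `G` would be abelian
    have hne : fixedPointSubgroup hG hfree ≠ ⊥ := by
      intro hbot
      rw [hbot, MonoidHom.ker_eq_bot_iff] at hρ
      refine hab fun f hf g hg => congrArg Subtype.val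
        (hρ (?_ : ρ (⟨f, hf⟩ * ⟨g, hg⟩) = ρ (⟨g, hg⟩ * ⟨f, hf⟩)))
      rw [map_mul, map_mul, mul_comm]
    have := countable_quotient hG (fun _ => id) hs hne
    exact ⟨K, Countable.of_equiv _ (e.toEquiv.trans Multiplicative.toAdd), ⟨e⟩⟩
  · exact exists_isFundamentalFamily hG (fun _ => id) s
  · have hres := fun n hn => h𝓘.exists_isRestriction hG hs (n := n) hn
    obtain ⟨r, hr, hrn⟩ := exists_restrictionHom hres
    refine ⟨h𝓘.countable, fun I hI => ?_, hres, hfree.of_surjective r hr,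
      exists_injective_hom_regularWreathProduct r fun n hn =>
        Subtype.ext (h𝓘.eq_one hs n.2 fun g x hx => ?_)⟩
    · obtain ⟨x, hx, rfl⟩ := h𝓘.isComponent I hI
      exact isOpenArc_connectedComponentIn (isOpen_orbitClosureCompl s)
        (orbitClosureCompl_ne_univ s) hx
    · obtain ⟨I, hI, hxI⟩ := hx
      have h1 := hrn ⟨g⁻¹ * n * g,
        by simpa using Subgroup.Normal.conj_mem inferInstance n.1 n.2 g⁻¹⟩ ⟨I, hI⟩ ⟨x, hxI⟩
      rw [hn g] at h1
      exact h1.symm
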